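/- Let $F$ be a complex-valued harmonic function in the upper half plane $\{z\in\mathbb{C} : \operatorname{Im} z>0\}$, and write $f_u(x)=F(x+iu)$ for $x\in\mathbb{R}$, $u>0$. Let $1<p\le\infty$, and let $$P_u(x)=\frac{u}{\pi(u^2+x^2)}\qquad(x\in\mathbb{R},\ u>0)$$ be the Poisson kernel. Then there exists $f\in L^p(\mathbb{R})$ such that $$f_u(x)=(P_u*f)(x)=\int_{\mathbb{R}}P_u(x-t)f(t)\,dt\qquad\text{for all } x\in\mathbb{R} \text{ and all } u>0$$ if and only if $f_u\in L^p(\mathbb{R})$ for every $u>0$ and $$\sup_{u>0}\|f_u\|_p<\infty.$$ -/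

import Mathlib

open scoped Convolution ENNReal

/-- The Poisson kernel of the real line, `P_u(x) = u / (π (u² + x²))` (meant for `u > 0`). -/
noncomputable def linePoissonKernel (u x : ℝ) : ℝ :=
  u / (Real.pi * (u ^ 2 + x ^ 2))

/-- The restriction `f_u(x) = F(x + i u)` of `F` to the horizontal line at height `u`. -/
noncomputable def horizontalSlice (F : ℂ → ℂ) (u x : ℝ) : ℂ :=
  F ((x : ℂ) + Complex.I * (u : ℂ))

/-!
If `F` is the Poisson integral of `f ∈ L^p`, each slice is the convolution of `f` with a probability
density, so Jensen's inequality and Tonelli's theorem give `‖f_u‖_p ≤ ‖f‖_p`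
(`eLpNorm_linePoissonKernel_convolution_le`).

Conversely, suppose that the slices are bounded in `L^p`; after splitting into real and imaginary
parts `F` is a real-valued harmonic function `v`.

* The mean value property over discs, integrated in polar coordinates, and Hölder's inequality on
  the slices show that `v` is bounded on each half plane `δ ≤ Im z`
  (`InnerProductSpace.HarmonicOnNhd.exists_bound_of_eLpNorm_slice_le`).
* A bounded harmonic function on a half plane is the Poisson integral of its values on any interior
  horizontal line (`InnerProductSpace.HarmonicOnNhd.eq_integral_linePoissonKernel`). This is the
  limit of Poisson's formula on discs of radius `1 / (2 ε)` tangent to that line: in the stereographic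
  parametrization the disc kernel is an explicit rational function of `t`, dominated by a multiple
  of the kernel of the half plane. Hence `v (x + i (u + d)) = ∫ P_u(x - t) v(t + i d) dt` for
  `d > 0`.
* Along an ultrafilter `d → 0` the slices `v(· + i d)` have a weak-* limit `f ∈ L^p`
  (`exists_ultrafilter_weakStar_limit`), and pairing with `P_u(x - ·) ∈ L^q` gives the formula for
  `f`. This is where `p ≠ 1` is needed: the conjugate exponent `q` must be finite.

The weak-* limit is obtained without the duality `(L^q)* = L^p`. For nonnegative functions `h n`
bounded in `L^p`, the limit functional `Λ ψ = lim ∫ h n * ψ` is additive and bounded on nonnegative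
`ψ ∈ L^q`, hence continuous along increasing sequences since `q < ∞`. Weighted by a positive
`w ∈ L^q` it becomes a finite measure absolutely continuous with respect to `μ`, and the
Radon-Nikodym derivative divided by `w` is the limit.
-/

open MeasureTheory Filter Topology

/-! ### Weak-* compactness in `L^p` -/

section WeakStar

variable {α ι : Type*} [MeasurableSpace α] {μ : Measure α} {p q M : ℝ≥0∞}

theorem lintegral_mul_le_eLpNorm_mul_eLpNorm [hpq : p.HolderConjugate q] (hq : q ≠ ∞)
    {f g : α → ℝ≥0∞} (hf : Measurable f) (hg : Measurable g) :
    ∫⁻ a, f a * g a ∂μ ≤ eLpNorm f p μ * eLpNorm g q μ := by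
  have hq0 : q ≠ 0 := ENNReal.HolderConjugate.ne_zero q p
  have hp0 : p ≠ 0 := ENNReal.HolderConjugate.ne_zero p q
  by_cases hp : p = ∞
  · subst hp
    obtain rfl : q = 1 := (ENNReal.HolderConjugate.unique ∞ q 1)
    rw [eLpNorm_exponent_top, eLpNorm_one_eq_lintegral_enorm,
      ← lintegral_const_mul _ (by fun_prop)]
    refine lintegral_mono_ae ?_
    filter_upwards [enorm_ae_le_eLpNormEssSup f μ] with x hx
    simp only [enorm_eq_self] at hx ⊢
    gcongr
  · rw [eLpNorm_eq_lintegral_rpow_enorm_toReal hp0 hp,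
      eLpNorm_eq_lintegral_rpow_enorm_toReal hq0 hq]
    have := ENNReal.HolderConjugate.toReal_of_ne_top hp hq (p := p) (q := q)
    simpa using ENNReal.lintegral_mul_le_Lp_mul_Lq μ this hf.aemeasurable hg.aemeasurable

/-- A converse of Hölder's inequality: a function whose pairing with every `ψ ∈ L^q` is bounded by
`M ‖ψ‖_q` has `L^p` norm at most `M`. -/
theorem eLpNorm_le_of_forall_lintegral_mul_le [SigmaFinite μ] [hpq : p.HolderConjugate q]
    (hq : q ≠ ∞) {g : α → ℝ≥0∞} (hg : Measurable g)
    (H : ∀ ψ : α → ℝ≥0∞, Measurable ψ → eLpNorm ψ q μ ≠ ∞ →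
      ∫⁻ a, g a * ψ a ∂μ ≤ M * eLpNorm ψ q μ) :
    eLpNorm g p μ ≤ M := by
  have hq0 : q ≠ 0 := ENNReal.HolderConjugate.ne_zero q p
  have hp0 : p ≠ 0 := ENNReal.HolderConjugate.ne_zero p q
  by_cases hp : p = ∞
  · subst hp
    obtain rfl : q = 1 := (ENNReal.HolderConjugate.unique ∞ q 1)
    rw [eLpNorm_exponent_top]
    refine essSup_le_of_ae_le _ ?_
    simp only [enorm_eq_self]
    refine ae_le_of_forall_setLIntegral_le_of_sigmaFinite hg fun s hs hμs ↦ ?_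
    have := H (s.indicator 1) (measurable_one.indicator hs)
    simp only [eLpNorm_one_eq_lintegral_enorm, enorm_eq_self, lintegral_indicator_one hs] at this
    have h2 := this hμs.ne
    rw [setLIntegral_const, ← lintegral_indicator hs]
    convert h2 using 3 with a
    by_cases ha : a ∈ s <;> simp [ha]
  · have hr : p.toReal.HolderConjugate q.toReal := ENNReal.HolderConjugate.toReal_of_ne_top hp hq
    have hr0 := hr.pos
    have hq0' := hr.symm.pos
    -- Truncations of `g` to finite height and finite measure
    let G : ℕ → α → ℝ≥0∞ := fun k ↦ (spanningSets μ k).indicator fun a ↦ min (g a) k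
    have hGm : ∀ k, Measurable (G k) := fun k ↦
      (hg.min measurable_const).indicator (measurableSet_spanningSets μ k)
    have hGle : ∀ k a, G k a ≤ g a := fun k a ↦ by
      by_cases ha : a ∈ spanningSets μ k <;> simp [G, ha]
    have hfin : ∀ k, ∫⁻ a, G k a ^ p.toReal ∂μ ≠ ∞ := fun k ↦ by
      refine ne_top_of_le_ne_top (b := (k : ℝ≥0∞) ^ p.toReal * μ (spanningSets μ k)) ?_ ?_
      · exact ENNReal.mul_ne_top (by finiteness) (measure_spanningSets_lt_top μ k).ne
      · rw [← lintegral_indicator_const (measurableSet_spanningSets μ k)]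
        refine lintegral_mono fun a ↦ ?_
        by_cases ha : a ∈ spanningSets μ k
        · simp only [G, ha, Set.indicator_of_mem]
          gcongr
          exact min_le_right _ _
        · simp [G, ha, hr0]
    -- Pairing `g` with `ψ = G k ^ (p - 1)`, whose `L^q` norm is `(∫ G k ^ p) ^ (1 / q)`.
    have key : ∀ k, ∫⁻ a, G k a ^ p.toReal ∂μ ≤ M ^ p.toReal := fun k ↦ by
      set J := ∫⁻ a, G k a ^ p.toReal ∂μ with hJ
      have e1 : eLpNorm (fun a ↦ G k a ^ (p.toReal - 1)) q μ = J ^ (1 / q.toReal) := by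
        rw [eLpNorm_eq_lintegral_rpow_enorm_toReal hq0 hq]
        congr 1
        refine lintegral_congr fun a ↦ ?_
        rw [enorm_eq_self, ← ENNReal.rpow_mul, hr.sub_one_mul_conj]
      have e2 := H (fun a ↦ G k a ^ (p.toReal - 1)) ((hGm k).pow_const _) (by
        rw [e1]; exact ENNReal.rpow_ne_top_of_nonneg (by positivity) (hfin k))
      rw [e1] at e2
      have e3 : J ≤ ∫⁻ a, g a * G k a ^ (p.toReal - 1) ∂μ := by
        refine lintegral_mono fun a ↦ ?_
        have : G k a ^ p.toReal = G k a * G k a ^ (p.toReal - 1) := by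
          have := ENNReal.rpow_add_of_nonneg (x := G k a) 1 (p.toReal - 1) zero_le_one
            hr.sub_one_pos.le
          rwa [ENNReal.rpow_one, add_sub_cancel] at this
        beta_reduce
        rw [this]
        gcongr
        exact hGle k a
      have e4 := e3.trans e2
      by_cases hJ0 : J = 0
      · rw [hJ0]; exact zero_le
      have hJt : J ≠ ∞ := hfin k
      have e5 : J ^ (1 / p.toReal) * J ^ (1 / q.toReal) = J := by
        rw [← ENNReal.rpow_add _ _ hJ0 hJt, hr.one_div_add_one_div, one_div_one, ENNReal.rpow_one]
      have e6 : J ^ (1 / p.toReal) ≤ M := by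
        rw [← e5] at e4
        nth_rw 2 [e5] at e4
        refine (ENNReal.mul_le_mul_iff_left ?_ ?_).1 e4
        · simp [hJ0, hJt]
        · exact ENNReal.rpow_ne_top_of_nonneg (by positivity) hJt
      calc J = (J ^ (1 / p.toReal)) ^ p.toReal := by
            rw [← ENNReal.rpow_mul, one_div_mul_cancel hr0.ne', ENNReal.rpow_one]
        _ ≤ _ := by gcongr
    have hmono : Monotone fun k a ↦ G k a ^ p.toReal := fun k l hkl a ↦ by
      dsimp only
      gcongr
      by_cases ha : a ∈ spanningSets μ k
      · have ha' := monotone_spanningSets μ hkl ha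
        simp only [G, ha, ha', Set.indicator_of_mem]
        gcongr
      · simp [G, ha]
    have hsup : ∀ a, ⨆ k, G k a ^ p.toReal = g a ^ p.toReal := fun a ↦ by
      refine tendsto_nhds_unique (tendsto_atTop_iSup fun k l hkl ↦ hmono hkl a) ?_
      refine ((ENNReal.continuous_rpow_const.tendsto _).comp ?_)
      have h1 : Tendsto (fun k : ℕ ↦ min (g a) (k : ℝ≥0∞)) atTop (𝓝 (min (g a) ∞)) :=
        tendsto_const_nhds.min ENNReal.tendsto_nat_nhds_top
      rw [min_eq_left le_top] at h1
      refine h1.congr' ?_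
      have : a ∈ ⋃ k, spanningSets μ k := by simp [iUnion_spanningSets]
      obtain ⟨k, hk⟩ := Set.mem_iUnion.1 this
      filter_upwards [eventually_ge_atTop k] with l hl
      simp [G, monotone_spanningSets μ hl hk]
    rw [eLpNorm_eq_lintegral_rpow_enorm_toReal hp0 hp, one_div, ENNReal.rpow_inv_le_iff hr0]
    simp only [enorm_eq_self, ← hsup]
    rw [lintegral_iSup (fun k ↦ (hGm k).pow_const _) hmono]
    exact iSup_le key

/-- Weak-* compactness of bounded sets in `L^p`, `1 < p ≤ ∞`, for nonnegative functions. -/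
theorem exists_ultrafilter_weakStar_limit_lintegral [SigmaFinite μ] [hpq : p.HolderConjugate q]
    (hq : q ≠ ∞) (hM : M ≠ ∞) (U : Ultrafilter ι) {h : ι → α → ℝ≥0∞} (hm : ∀ n, Measurable (h n))
    (hb : ∀ n, eLpNorm (h n) p μ ≤ M) :
    ∃ g : α → ℝ≥0∞, Measurable g ∧ eLpNorm g p μ ≤ M ∧
      ∀ ψ : α → ℝ≥0∞, Measurable ψ → eLpNorm ψ q μ ≠ ∞ →
        Tendsto (fun n ↦ ∫⁻ a, h n a * ψ a ∂μ) U (𝓝 (∫⁻ a, g a * ψ a ∂μ)) := by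
  have hq0 : q ≠ 0 := ENNReal.HolderConjugate.ne_zero q p
  have hq0' : 0 < q.toReal := ENNReal.toReal_pos hq0 hq
  let Λ : (α → ℝ≥0∞) → ℝ≥0∞ := fun ψ ↦ (U.map fun n ↦ ∫⁻ a, h n a * ψ a ∂μ).lim
  have hΛ : ∀ ψ, Tendsto (fun n ↦ ∫⁻ a, h n a * ψ a ∂μ) U (𝓝 (Λ ψ)) := fun ψ ↦
    (U.map fun n ↦ ∫⁻ a, h n a * ψ a ∂μ).le_nhds_lim
  have Λ_le : ∀ ψ, Measurable ψ → Λ ψ ≤ M * eLpNorm ψ q μ := fun ψ hψ ↦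
    le_of_tendsto' (hΛ ψ) fun n ↦ (lintegral_mul_le_eLpNorm_mul_eLpNorm hq (hm n) hψ).trans
      (by gcongr; exact hb n)
  have Λ_add : ∀ ψ φ, Measurable ψ → Λ (ψ + φ) = Λ ψ + Λ φ := fun ψ φ hψ ↦ by
    refine tendsto_nhds_unique (hΛ _) (((hΛ ψ).add (hΛ φ)).congr fun n ↦ ?_)
    rw [← lintegral_add_left (by have := hm n; fun_prop)]
    simp [mul_add]
  have Λ_mono : ∀ ψ φ, ψ ≤ φ → Λ ψ ≤ Λ φ := fun ψ φ hle ↦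
    le_of_tendsto_of_tendsto' (hΛ ψ) (hΛ φ) fun n ↦ lintegral_mono fun a ↦ by
      dsimp only; gcongr; exact hle a
  have Λ_smul : ∀ (c : ℝ≥0∞) ψ, c ≠ ∞ → Measurable ψ → Λ (fun a ↦ c * ψ a) = c * Λ ψ :=
    fun c ψ hc hψ ↦ by
    refine tendsto_nhds_unique (hΛ _)
      ((ENNReal.Tendsto.const_mul (hΛ ψ) (.inr hc)).congr fun n ↦ ?_)
    rw [← lintegral_const_mul _ (by have := hm n; fun_prop)]
    exact lintegral_congr fun a ↦ by ring
  have Λ_zero : Λ 0 = 0 := by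
    refine le_antisymm ((Λ_le 0 measurable_zero).trans ?_) zero_le
    simp
  -- `Λ` is continuous along increasing sequences with limit in `L^q`: the remainders tend to `0` in
  -- `L^q` by dominated convergence.
  have Λ_iSup : ∀ ψ : ℕ → α → ℝ≥0∞, (∀ k, Measurable (ψ k)) → Monotone ψ →
      eLpNorm (fun a ↦ ⨆ k, ψ k a) q μ ≠ ∞ → Λ (fun a ↦ ⨆ k, ψ k a) = ⨆ k, Λ (ψ k) := by
    intro ψ hψm hψ hfin
    set φ : α → ℝ≥0∞ := fun a ↦ ⨆ k, ψ k a with hφ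
    have hφm : Measurable φ := Measurable.iSup hψm
    have hle : ∀ k, ψ k ≤ φ := fun k a ↦ le_iSup (fun k ↦ ψ k a) k
    have hfin' : ∫⁻ a, φ a ^ q.toReal ∂μ ≠ ∞ := by
      rw [eLpNorm_eq_lintegral_rpow_enorm_toReal hq0 hq] at hfin
      simpa [hq0'] using hfin
    refine le_antisymm ?_ (iSup_le fun k ↦ Λ_mono _ _ (hle k))
    have h0 : Tendsto (fun k ↦ eLpNorm (fun a ↦ φ a - ψ k a) q μ) atTop (𝓝 0) := by
      simp_rw [eLpNorm_eq_lintegral_rpow_enorm_toReal hq0 hq, enorm_eq_self]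
      have : Tendsto (fun k ↦ ∫⁻ a, (φ a - ψ k a) ^ q.toReal ∂μ) atTop (𝓝 (∫⁻ a, 0 ∂μ)) := by
        refine tendsto_lintegral_of_dominated_convergence (fun a ↦ φ a ^ q.toReal)
          (fun k ↦ (hφm.sub (hψm k)).pow_const _) (fun k ↦ .of_forall fun a ↦ ?_) hfin' ?_
        · dsimp only; gcongr; exact tsub_le_self
        · filter_upwards [ae_lt_top (hφm.pow_const _) hfin'] with a ha
          have ha' : φ a ≠ ∞ := by
            intro h; simp [h, hq0'] at ha
          have h1 : Tendsto (fun k ↦ φ a - ψ k a) atTop (𝓝 (φ a - φ a)) :=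
            ENNReal.Tendsto.sub tendsto_const_nhds
              (tendsto_atTop_iSup fun k l hkl ↦ hψ hkl a) (.inl ha')
          rw [tsub_self] at h1
          have h2 := (ENNReal.continuous_rpow_const (y := q.toReal)).tendsto 0 |>.comp h1
          simpa [Function.comp_def, hq0'] using h2
      rw [lintegral_zero] at this
      have h2 := (ENNReal.continuous_rpow_const (y := 1 / q.toReal)).tendsto 0 |>.comp this
      rw [ENNReal.zero_rpow_of_pos (by positivity)] at h2
      exact h2
    have h1 : Tendsto (fun k ↦ (⨆ k, Λ (ψ k)) + M * eLpNorm (fun a ↦ φ a - ψ k a) q μ) atTop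
        (𝓝 ((⨆ k, Λ (ψ k)) + M * 0)) :=
      tendsto_const_nhds.add (ENNReal.Tendsto.const_mul h0 (.inr hM))
    rw [mul_zero, add_zero] at h1
    refine ge_of_tendsto' h1 fun k ↦ ?_
    have : φ = ψ k + fun a ↦ φ a - ψ k a := by
      funext a; exact (add_tsub_cancel_of_le (hle k a)).symm
    calc Λ φ = Λ (ψ k) + Λ (fun a ↦ φ a - ψ k a) := by rw [← Λ_add _ _ (hψm k), ← this]
      _ ≤ _ := add_le_add (le_iSup (fun k ↦ Λ (ψ k)) k) (Λ_le _ (hφm.sub (hψm k)))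
  -- A strictly positive weight in `L^q`, which makes the measure `ν` below finite.
  obtain ⟨w₀, w₀pos, w₀m, w₀int⟩ := exists_pos_lintegral_lt_of_sigmaFinite μ one_ne_zero
  let w : α → ℝ≥0∞ := fun a ↦ (w₀ a : ℝ≥0∞) ^ (1 / q.toReal)
  have wm : Measurable w := (measurable_coe_nnreal_ennreal.comp w₀m).pow_const _
  have wq : ∀ a, w a ^ q.toReal = w₀ a := fun a ↦ by
    rw [← ENNReal.rpow_mul, one_div_mul_cancel hq0'.ne', ENNReal.rpow_one]
  have w0 : ∀ a, w a ≠ 0 := fun a ↦ by simp [w, (w₀pos a).ne']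
  have wt : ∀ a, w a ≠ ∞ := fun a ↦ by
    refine ENNReal.rpow_ne_top_of_nonneg (by positivity) ENNReal.coe_ne_top
  have wfin : eLpNorm w q μ ≠ ∞ := by
    rw [eLpNorm_eq_lintegral_rpow_enorm_toReal hq0 hq]
    refine ENNReal.rpow_ne_top_of_nonneg (by positivity) ?_
    simp only [enorm_eq_self, wq]
    exact (w₀int.trans ENNReal.one_lt_top).ne
  have mono_norm : ∀ {ψ φ : α → ℝ≥0∞}, ψ ≤ φ → eLpNorm ψ q μ ≤ eLpNorm φ q μ := fun hle ↦
    eLpNorm_mono_enorm fun a ↦ by simpa using hle a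
  have Λ_sum : ∀ (ψ : ℕ → α → ℝ≥0∞), (∀ k, Measurable (ψ k)) → ∀ N,
      Λ (∑ k ∈ Finset.range N, ψ k) = ∑ k ∈ Finset.range N, Λ (ψ k) := by
    intro ψ hψ N
    induction N with
    | zero => simp [Λ_zero]
    | succ N ih =>
      rw [Finset.sum_range_succ, Finset.sum_range_succ, Λ_add _ _ (by fun_prop), ih]
  let ν : Measure α := Measure.ofMeasurable (fun s _ ↦ Λ (s.indicator w)) (by
    exact (congrArg Λ (Set.indicator_empty w)).trans Λ_zero) (by
    intro A hA hd
    have hsum : ((⋃ i, A i).indicator w) =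
        fun a ↦ ⨆ N, (∑ k ∈ Finset.range N, (A k).indicator w) a := by
      funext a
      simp only [Finset.sum_apply]
      rw [← ENNReal.tsum_eq_iSup_nat]
      by_cases ha : a ∈ ⋃ i, A i
      · rw [Set.indicator_of_mem ha]
        obtain ⟨i, hi⟩ := Set.mem_iUnion.1 ha
        rw [tsum_eq_single i, Set.indicator_of_mem hi]
        intro j hj
        exact Set.indicator_of_notMem (fun h' ↦ Set.disjoint_left.1 (hd hj) h' hi) _
      · rw [Set.indicator_of_notMem ha]
        have : ∀ i, a ∉ A i := by simpa using ha
        simp [this]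
    rw [hsum, Λ_iSup _ ?_ ?_ ?_, ENNReal.tsum_eq_iSup_nat]
    · simp_rw [Λ_sum _ (fun k ↦ wm.indicator (hA k))]
    · have := fun k ↦ wm.indicator (hA k)
      intro N
      fun_prop
    · intro N N' hN a
      simp only [Finset.sum_apply]
      exact Finset.sum_le_sum_of_subset (Finset.range_mono hN)
    · rw [← hsum]
      exact ne_top_of_le_ne_top wfin (mono_norm fun a ↦ Set.indicator_le_self _ _ a))
  have hν : ∀ s, MeasurableSet s → ν s = Λ (s.indicator w) := fun s hs ↦
    Measure.ofMeasurable_apply s hs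
  have hac : ν ≪ μ := by
    refine Measure.AbsolutelyContinuous.mk fun s hs hs0 ↦ ?_
    rw [hν s hs]
    refine le_antisymm ((Λ_le _ (wm.indicator hs)).trans ?_) zero_le
    have : s.indicator w =ᵐ[μ] 0 := indicator_meas_zero hs0
    rw [eLpNorm_congr_ae this]; simp
  have hfin : IsFiniteMeasure ν := ⟨by
    rw [hν _ .univ, Set.indicator_univ]
    exact (Λ_le w wm).trans_lt (ENNReal.mul_lt_top hM.lt_top wfin.lt_top)⟩
  -- The condition on `φ * w` passes to summands and to members of increasing sequences, so the
  -- measurable induction applies to the implication.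
  have key : ∀ φ : α → ℝ≥0∞, Measurable φ → eLpNorm (fun a ↦ φ a * w a) q μ ≠ ∞ →
      Λ (fun a ↦ φ a * w a) = ∫⁻ a, φ a ∂ν := by
    intro φ hφ
    refine Measurable.ennreal_induction (motive := fun φ ↦ eLpNorm (fun a ↦ φ a * w a) q μ ≠ ∞ →
      Λ (fun a ↦ φ a * w a) = ∫⁻ a, φ a ∂ν) (fun c s hs ↦ ?_) (fun f g _ hf hg ihf ihg ↦ ?_)
      (fun f hf hmono ih ↦ ?_) hφ
    · intro hf
      have e : (fun a ↦ s.indicator (fun _ ↦ c) a * w a) = fun a ↦ c * s.indicator w a := by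
        funext a; by_cases ha : a ∈ s <;> simp [ha]
      rw [lintegral_indicator_const hs, hν s hs]
      rw [e] at hf ⊢
      -- For `c = ∞` finiteness of the norm forces `s` to be null.
      by_cases hc : c = ∞
      · subst hc
        have hs0 : μ s = 0 := by
          by_contra hne
          apply hf
          rw [eq_top_iff]
          have h1 : ∫⁻ a, (∞ : ℝ≥0∞) * s.indicator w a ^ q.toReal ∂μ
              ≤ ∫⁻ a, ‖(∞ : ℝ≥0∞) * s.indicator w a‖ₑ ^ q.toReal ∂μ := by
            refine lintegral_mono fun a ↦ ?_
            rw [enorm_eq_self, ENNReal.mul_rpow_of_nonneg _ _ hq0'.le, ENNReal.top_rpow_of_pos hq0']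
          rw [lintegral_const_mul _ ((wm.indicator hs).pow_const _), ENNReal.top_mul] at h1
          · rw [eLpNorm_eq_lintegral_rpow_enorm_toReal hq0 hq, top_le_iff.1 h1,
              ENNReal.top_rpow_of_pos (by positivity)]
          · rw [Ne, lintegral_eq_zero_iff (by have := wm.indicator hs; fun_prop)]
            intro h0
            apply hne
            refine measure_mono_null (fun a ha ↦ ?_) h0
            simp [ha, hq0', w0, hq0'.le]
        have h1 : s.indicator w =ᵐ[μ] 0 := indicator_meas_zero hs0
        have h2 : (fun a ↦ ∞ * s.indicator w a) =ᵐ[μ] 0 := by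
          filter_upwards [h1] with a ha; simp [ha]
        have h3 := Λ_le _ (wm.indicator hs)
        have h4 := Λ_le _ ((wm.indicator hs).const_mul ∞)
        rw [eLpNorm_congr_ae h1] at h3
        rw [eLpNorm_congr_ae h2] at h4
        simp only [eLpNorm_zero, mul_zero, nonpos_iff_eq_zero] at h3 h4
        rw [h3, h4, mul_zero]
      · exact Λ_smul c _ hc (wm.indicator hs)
    · intro hfg
      have e : (fun a ↦ (f + g) a * w a) = (fun a ↦ f a * w a) + fun a ↦ g a * w a := by
        funext a; simp [add_mul]
      have h1 : eLpNorm (fun a ↦ f a * w a) q μ ≠ ∞ := by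
        refine ne_top_of_le_ne_top hfg (mono_norm fun a ↦ ?_)
        dsimp only [Pi.add_apply]; gcongr; exact le_self_add
      have h2 : eLpNorm (fun a ↦ g a * w a) q μ ≠ ∞ := by
        refine ne_top_of_le_ne_top hfg (mono_norm fun a ↦ ?_)
        dsimp only [Pi.add_apply]; gcongr; exact le_add_self
      rw [e, Λ_add _ _ (by fun_prop), ihf h1, ihg h2, ← lintegral_add_left hf]
      rfl
    · dsimp only
      intro hsup
      simp only [ENNReal.iSup_mul] at hsup ⊢
      rw [Λ_iSup (fun k a ↦ f k a * w a) (fun k ↦ (hf k).mul wm) _ hsup,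
        lintegral_iSup hf hmono]
      · refine iSup_congr fun k ↦ ih k ?_
        refine ne_top_of_le_ne_top hsup (mono_norm fun a ↦ ?_)
        exact le_iSup (fun k ↦ f k a * w a) k
      · intro k l hkl a
        dsimp only
        gcongr
        exact hmono hkl a
  have gm : Measurable fun a ↦ ν.rnDeriv μ a / w a := (Measure.measurable_rnDeriv ν μ).div wm
  have pairing : ∀ ψ : α → ℝ≥0∞, Measurable ψ → eLpNorm ψ q μ ≠ ∞ →
      ∫⁻ a, ν.rnDeriv μ a / w a * ψ a ∂μ = Λ ψ := by
    intro ψ hψ hψf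
    have e : (fun a ↦ ψ a / w a * w a) = ψ := by
      funext a; exact ENNReal.div_mul_cancel (w0 a) (wt a)
    have := key (fun a ↦ ψ a / w a) (hψ.div wm) (by rwa [e])
    rw [e] at this
    rw [this, ← lintegral_rnDeriv_mul hac (f := fun a ↦ ψ a / w a) (hψ.div wm).aemeasurable]
    refine lintegral_congr fun a ↦ ?_
    simp only [div_eq_mul_inv]; ring
  refine ⟨fun a ↦ ν.rnDeriv μ a / w a, gm, ?_, fun ψ hψ hψf ↦ ?_⟩
  · refine eLpNorm_le_of_forall_lintegral_mul_le hq gm fun ψ hψ hψf ↦ ?_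
    rw [pairing ψ hψ hψf]
    exact Λ_le ψ hψ
  · rw [pairing ψ hψ hψf]
    exact hΛ ψ

theorem ae_lt_top_of_eLpNorm_ne_top (hp : p ≠ 0) {g : α → ℝ≥0∞} (hg : Measurable g)
    (h : eLpNorm g p μ ≠ ∞) : ∀ᵐ a ∂μ, g a < ∞ := by
  by_cases hp' : p = ∞
  · subst hp'
    filter_upwards [enorm_ae_le_eLpNormEssSup g μ] with a ha
    exact ha.trans_lt h.lt_top
  · have hp0 := ENNReal.toReal_pos hp hp'
    rw [eLpNorm_eq_lintegral_rpow_enorm_toReal hp hp'] at h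
    have h' : ∫⁻ a, g a ^ p.toReal ∂μ ≠ ∞ := by simpa [hp0] using h
    filter_upwards [ae_lt_top (hg.pow_const _) h'] with a ha
    rw [lt_top_iff_ne_top]
    rintro h; simp [h, hp0] at ha

/-- Weak-* compactness of bounded sets in real `L^p`, `1 < p ≤ ∞`, tested against nonnegative
functions. The limit is taken separately for the positive and negative parts. -/
theorem exists_ultrafilter_weakStar_limit [SigmaFinite μ] [hpq : p.HolderConjugate q]
    (hq : q ≠ ∞) (hM : M ≠ ∞) (U : Ultrafilter ι) {f : ι → α → ℝ} (hm : ∀ n, Measurable (f n))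
    (hb : ∀ n, eLpNorm (f n) p μ ≤ M) :
    ∃ g : α → ℝ, MemLp g p μ ∧
      ∀ ψ : α → ℝ, Measurable ψ → (∀ a, 0 ≤ ψ a) → MemLp ψ q μ →
        Tendsto (fun n ↦ ∫ a, f n a * ψ a ∂μ) U (𝓝 (∫ a, g a * ψ a ∂μ)) := by
  have hp0 : p ≠ 0 := ENNReal.HolderConjugate.ne_zero p q
  obtain ⟨g₁, hg₁, hb₁, hT₁⟩ := exists_ultrafilter_weakStar_limit_lintegral (μ := μ) (p := p)
    hq hM U (h := fun n a ↦ ENNReal.ofReal (f n a)) (fun n ↦ (hm n).ennreal_ofReal) fun n ↦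
      (eLpNorm_mono_enorm fun a ↦ by simpa using Real.ofReal_le_enorm _).trans (hb n)
  obtain ⟨g₂, hg₂, hb₂, hT₂⟩ := exists_ultrafilter_weakStar_limit_lintegral (μ := μ) (p := p)
    hq hM U (h := fun n a ↦ ENNReal.ofReal (-f n a)) (fun n ↦ (hm n).neg.ennreal_ofReal) fun n ↦
      (eLpNorm_mono_enorm fun a ↦ by simpa using Real.ofReal_le_enorm (-f n a)).trans (hb n)
  have mem : ∀ g : α → ℝ≥0∞, Measurable g → eLpNorm g p μ ≤ M → MemLp (fun a ↦ (g a).toReal) p μ :=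
    fun g hg hgb ↦ ⟨hg.ennreal_toReal.aestronglyMeasurable, by
      refine lt_of_le_of_lt (eLpNorm_mono_enorm fun a ↦ ?_) (hgb.trans_lt hM.lt_top)
      rw [Real.enorm_of_nonneg ENNReal.toReal_nonneg, enorm_eq_self]
      exact ENNReal.ofReal_toReal_le⟩
  have pair : ∀ g : α → ℝ≥0∞, Measurable g → eLpNorm g p μ ≤ M → ∀ ψ : α → ℝ, Measurable ψ →
      (∀ a, 0 ≤ ψ a) →
      ∫ a, (g a).toReal * ψ a ∂μ = (∫⁻ a, g a * ENNReal.ofReal (ψ a) ∂μ).toReal := by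
    intro g hg hgb ψ hψ hψ0
    rw [← integral_toReal (by fun_prop)]
    · exact integral_congr_ae (.of_forall fun a ↦ by simp [ENNReal.toReal_ofReal (hψ0 a)])
    · filter_upwards [ae_lt_top_of_eLpNorm_ne_top hp0 hg (ne_top_of_le_ne_top hM hgb)] with a ha
      exact ENNReal.mul_lt_top ha ENNReal.ofReal_lt_top
  refine ⟨fun a ↦ (g₁ a).toReal - (g₂ a).toReal, (mem g₁ hg₁ hb₁).sub (mem g₂ hg₂ hb₂),
    fun ψ hψ hψ0 hψq ↦ ?_⟩
  have hψq' : eLpNorm (fun a ↦ ENNReal.ofReal (ψ a)) q μ ≠ ∞ := by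
    refine ne_top_of_le_ne_top hψq.2.ne (eLpNorm_mono_enorm fun a ↦ ?_)
    simpa using Real.ofReal_le_enorm _
  have hfin : ∀ g : α → ℝ≥0∞, Measurable g → eLpNorm g p μ ≤ M →
      ∫⁻ a, g a * ENNReal.ofReal (ψ a) ∂μ ≠ ∞ := fun g hg hgb ↦
    ne_top_of_le_ne_top (ENNReal.mul_ne_top (ne_top_of_le_ne_top hM hgb) hψq')
      (lintegral_mul_le_eLpNorm_mul_eLpNorm hq hg hψ.ennreal_ofReal)
  have int : ∀ g : α → ℝ, MemLp g p μ → Integrable (fun a ↦ g a * ψ a) μ := fun g hg ↦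
    hg.integrable_mul hψq
  have T := ((ENNReal.tendsto_toReal (hfin g₁ hg₁ hb₁)).comp (hT₁ _ hψ.ennreal_ofReal hψq')).sub
    ((ENNReal.tendsto_toReal (hfin g₂ hg₂ hb₂)).comp (hT₂ _ hψ.ennreal_ofReal hψq'))
  rw [← pair g₁ hg₁ hb₁ ψ hψ hψ0, ← pair g₂ hg₂ hb₂ ψ hψ hψ0,
    ← integral_sub (int _ (mem g₁ hg₁ hb₁)) (int _ (mem g₂ hg₂ hb₂))] at T
  simp_rw [← sub_mul] at T
  refine T.congr fun n ↦ ?_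
  rw [integral_eq_lintegral_pos_part_sub_lintegral_neg_part
    (int (f n) ⟨(hm n).aestronglyMeasurable, (hb n).trans_lt hM.lt_top⟩)]
  simp only [Function.comp_apply, ← neg_mul, ENNReal.ofReal_mul' (hψ0 _)]

end WeakStar

/-! ### The Poisson kernel of the half plane -/

theorem linePoissonKernel_neg (u x : ℝ) : linePoissonKernel u (-x) = linePoissonKernel u x := by
  simp [linePoissonKernel]

theorem linePoissonKernel_nonneg {u : ℝ} (hu : 0 ≤ u) (t : ℝ) : 0 ≤ linePoissonKernel u t := by
  unfold linePoissonKernel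
  have := Real.pi_pos
  positivity

theorem linePoissonKernel_eq_inv {u : ℝ} (hu : u ≠ 0) (t : ℝ) :
    linePoissonKernel u t = (Real.pi * u)⁻¹ * (1 + (u⁻¹ * t) ^ 2)⁻¹ := by
  unfold linePoissonKernel
  have := Real.pi_pos
  have : u ^ 2 + t ^ 2 ≠ 0 := by positivity
  field_simp

theorem integrable_linePoissonKernel {u : ℝ} (hu : u ≠ 0) : Integrable (linePoissonKernel u) := by
  simp_rw [funext (linePoissonKernel_eq_inv hu)]
  exact (integrable_inv_one_add_sq.comp_mul_left' (inv_ne_zero hu)).const_mul _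

theorem continuous_linePoissonKernel {u : ℝ} (hu : u ≠ 0) : Continuous (linePoissonKernel u) := by
  have := Real.pi_pos
  have : ∀ x : ℝ, Real.pi * (u ^ 2 + x ^ 2) ≠ 0 := fun x ↦ by positivity
  unfold linePoissonKernel
  fun_prop (disch := assumption)

theorem integral_linePoissonKernel {u : ℝ} (hu : 0 < u) : ∫ t, linePoissonKernel u t = 1 := by
  have := Real.pi_pos
  simp_rw [linePoissonKernel_eq_inv hu.ne']
  rw [integral_const_mul, Measure.integral_comp_mul_left (fun t : ℝ ↦ (1 + t ^ 2)⁻¹),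
    integral_univ_inv_one_add_sq, inv_inv, abs_of_pos hu, smul_eq_mul, mul_comm u,
    inv_mul_cancel₀ (by positivity)]

theorem memLp_linePoissonKernel {u : ℝ} (hu : 0 < u) {q : ℝ≥0∞} (hq : 1 ≤ q) (hq' : q ≠ ∞) :
    MemLp (linePoissonKernel u) q volume := by
  have hpi := Real.pi_pos
  have hq1 : 1 ≤ q.toReal := by simpa using ENNReal.toReal_mono hq' hq
  have hb : ∀ t, linePoissonKernel u t ≤ (Real.pi * u)⁻¹ := fun t ↦ by
    rw [linePoissonKernel_eq_inv hu.ne']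
    exact mul_le_of_le_one_right (by positivity)
      (inv_le_one_of_one_le₀ (by nlinarith [sq_nonneg (u⁻¹ * t)]))
  have hc := continuous_linePoissonKernel hu.ne'
  refine (integrable_norm_rpow_iff hc.aestronglyMeasurable (by positivity) hq').1 ?_
  refine ((integrable_linePoissonKernel hu.ne').const_mul ((Real.pi * u)⁻¹ ^ (q.toReal - 1))).mono'
    (hc.norm.rpow_const fun _ ↦ .inr (by positivity)).aestronglyMeasurable (.of_forall fun t ↦ ?_)
  have h0 := linePoissonKernel_nonneg hu.le t
  rw [Real.norm_of_nonneg h0, Real.norm_of_nonneg (by positivity)]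
  calc linePoissonKernel u t ^ q.toReal =
        linePoissonKernel u t ^ (q.toReal - 1) * linePoissonKernel u t := by
        conv_rhs => rw [← Real.rpow_one (linePoissonKernel u t), ← Real.rpow_mul h0, one_mul]
        rw [← Real.rpow_add_of_nonneg h0 (by linarith) zero_le_one, sub_add_cancel]
    _ ≤ _ := by
      have := hb t
      have : 0 ≤ q.toReal - 1 := by linarith
      gcongr

/-! ### Bounds for harmonic functions from their slices -/

theorem measurable_indicator_of_continuousOn {X : Type*} [TopologicalSpace X] [MeasurableSpace X]
    [OpensMeasurableSpace X] {s : Set X} (hs : MeasurableSet s) {f : X → ℝ≥0∞}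
    (hf : ContinuousOn f s) : Measurable (s.indicator f) := by
  classical
  have : Measurable (s.piecewise f 0) := hf.measurable_piecewise continuousOn_const hs
  rwa [Set.piecewise_eq_indicator] at this

theorem InnerProductSpace.HarmonicOnNhd.ofReal_two_pi_mul_enorm_le_lintegral {v : ℂ → ℝ} {z : ℂ}
    {r : ℝ} (hr : 0 ≤ r) (hv : InnerProductSpace.HarmonicOnNhd v (Metric.closedBall z r)) :
    ENNReal.ofReal (2 * Real.pi) * ‖v z‖ₑ ≤
      ∫⁻ θ in Set.Ioo (-Real.pi) Real.pi, ‖v (circleMap z r θ)‖ₑ := by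
  have h := hv.mono (t := Metric.closedBall z |r|) (by rw [abs_of_nonneg hr]) |>.circleAverage_eq
  rw [Real.circleAverage_eq_integral_add (-Real.pi),
    intervalIntegral.integral_comp_add_right (fun θ ↦ v (circleMap z r θ))] at h
  have hpi := Real.pi_pos
  have h2 : (2 * Real.pi) * v z = ∫ θ in Set.Ioo (-Real.pi) Real.pi, v (circleMap z r θ) := by
    rw [← h, ← integral_Ioc_eq_integral_Ioo, intervalIntegral.integral_of_le (by linarith),
      smul_eq_mul, mul_inv_cancel_left₀ (by positivity)]
    congr 3 <;> ring
  calc _ = ‖(2 * Real.pi) * v z‖ₑ := by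
        rw [enorm_mul, Real.enorm_of_nonneg (by positivity : 0 ≤ 2 * Real.pi)]
    _ ≤ _ := by rw [h2]; exact enorm_integral_le_lintegral_enorm _

/-- Area form of the mean value inequality, up to a constant depending only on the radius. -/
theorem InnerProductSpace.HarmonicOnNhd.mul_enorm_le_lintegral_ball {v : ℂ → ℝ} {z : ℂ} {R : ℝ}
    (hv : InnerProductSpace.HarmonicOnNhd v (Metric.ball z R)) :
    (∫⁻ r in Set.Ioo 0 R, ENNReal.ofReal r) * (ENNReal.ofReal (2 * Real.pi) * ‖v z‖ₑ) ≤
      ∫⁻ w in Metric.ball z R, ‖v w‖ₑ := by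
  let G : ℂ → ℝ≥0∞ := (Metric.ball z R).indicator fun w ↦ ‖v w‖ₑ
  have hG : Measurable G :=
    measurable_indicator_of_continuousOn Metric.isOpen_ball.measurableSet
      (continuous_enorm.comp_continuousOn hv.continuousOn)
  have hmap : ∀ r θ, z + Complex.polarCoord.symm (r, θ) = circleMap z r θ := fun r θ ↦ by
    simp [Complex.polarCoord_symm_apply, circleMap, Complex.exp_mul_I]
  rw [← lintegral_indicator Metric.isOpen_ball.measurableSet]
  change _ ≤ ∫⁻ w, G w
  rw [← lintegral_add_left_eq_self G z, ← Complex.lintegral_comp_polarCoord_symm]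
  simp only [smul_eq_mul]
  have hm : Measurable fun q : ℝ × ℝ ↦ ENNReal.ofReal q.1 * G (z + Complex.polarCoord.symm q) := by
    have : Continuous fun q : ℝ × ℝ ↦ circleMap z q.1 q.2 := by unfold circleMap; fun_prop
    have h2 : (fun q : ℝ × ℝ ↦ z + Complex.polarCoord.symm q) = fun q ↦ circleMap z q.1 q.2 := by
      funext q; exact hmap q.1 q.2
    have h3 : Measurable fun q : ℝ × ℝ ↦ z + Complex.polarCoord.symm q := by
      rw [h2]; exact this.measurable
    fun_prop
  rw [polarCoord_target, Measure.volume_eq_prod, ← Measure.prod_restrict,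
    lintegral_prod _ hm.aemeasurable]
  calc _ = ∫⁻ r in Set.Ioo 0 R, ENNReal.ofReal r * (ENNReal.ofReal (2 * Real.pi) * ‖v z‖ₑ) :=
        (lintegral_mul_const _ (by fun_prop)).symm
    _ ≤ ∫⁻ r in Set.Ioo 0 R, ∫⁻ θ in Set.Ioo (-Real.pi) Real.pi,
          ENNReal.ofReal r * G (z + Complex.polarCoord.symm (r, θ)) := by
        refine setLIntegral_mono' measurableSet_Ioo fun r hr ↦ ?_
        rw [lintegral_const_mul']
        · gcongr
          refine (InnerProductSpace.HarmonicOnNhd.ofReal_two_pi_mul_enorm_le_lintegral hr.1.le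
            (hv.mono (Metric.closedBall_subset_ball hr.2))).trans_eq ?_
          refine lintegral_congr fun θ ↦ ?_
          rw [hmap]
          simp only [G]
          rw [Set.indicator_of_mem]
          simp [circleMap, abs_of_pos hr.1, hr.2]
        · exact ENNReal.ofReal_ne_top
    _ ≤ _ := lintegral_mono_set Set.Ioo_subset_Ioi_self

/-- Hölder's inequality on each horizontal slice turns the area mean value inequality into a uniform
bound away from the real axis. -/
theorem InnerProductSpace.HarmonicOnNhd.exists_bound_of_eLpNorm_slice_le {v : ℂ → ℝ} {p M : ℝ≥0∞}
    (hp : 1 ≤ p) (hM : M ≠ ∞)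
    (hv : InnerProductSpace.HarmonicOnNhd v {z : ℂ | 0 < z.im})
    (hb : ∀ u : ℝ, 0 < u → eLpNorm (fun x : ℝ ↦ v (x + Complex.I * u)) p volume ≤ M)
    {δ : ℝ} (hδ : 0 < δ) : ∃ C : ℝ, ∀ z : ℂ, δ ≤ z.im → |v z| ≤ C := by
  have hcont : ∀ u : ℝ, 0 < u → Continuous fun x : ℝ ↦ v (x + Complex.I * u) := fun u hu ↦
    hv.continuousOn.comp_continuous (by fun_prop) fun x ↦ by simpa using hu
  set K := (∫⁻ r in Set.Ioo 0 δ, ENNReal.ofReal r) * ENNReal.ofReal (2 * Real.pi) with hK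
  have hK0 : K ≠ 0 := by
    refine mul_ne_zero ?_ (by simp [Real.pi_pos])
    rw [Ne, lintegral_eq_zero_iff (by fun_prop)]
    intro h
    rw [Filter.EventuallyEq, ae_restrict_iff' measurableSet_Ioo] at h
    have h2 : volume (Set.Ioo 0 δ) = 0 := measure_mono_null (fun r hr ↦ by
      simp only [Set.mem_compl_iff, Set.mem_ofPred_eq, not_forall]
      exact ⟨hr, by simpa using hr.1⟩) h
    simp [hδ.not_ge] at h2
  let B := ENNReal.ofReal (2 * δ) * (M * ENNReal.ofReal (2 * δ) ^ (1 - 1 / p.toReal))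
  have hp' : 0 ≤ 1 - 1 / p.toReal := by
    by_cases h : p = ∞
    · simp [h]
    · have : 1 ≤ p.toReal := by simpa using ENNReal.toReal_mono h hp
      have := (div_le_one (by linarith)).2 this
      linarith
  have hB : B ≠ ∞ := by
    refine ENNReal.mul_ne_top ENNReal.ofReal_ne_top (ENNReal.mul_ne_top hM ?_)
    exact ENNReal.rpow_ne_top_of_nonneg hp' ENNReal.ofReal_ne_top
  refine ⟨(B / K).toReal, fun z hz ↦ ?_⟩
  have hsub : Metric.ball z δ ⊆ {z : ℂ | 0 < z.im} := fun w hw ↦ by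
    have := (Complex.abs_im_le_norm (w - z)).trans_lt (mem_ball_iff_norm.1 hw)
    rw [Complex.sub_im, abs_lt] at this
    simp only [Set.mem_ofPred_eq]; linarith
  have h1 := InnerProductSpace.HarmonicOnNhd.mul_enorm_le_lintegral_ball (hv.mono hsub)
  rw [← mul_assoc, ← hK] at h1
  have h2 : ∫⁻ w in Metric.ball z δ, ‖v w‖ₑ ≤ B := by
    let S := Set.Ioo (z.re - δ) (z.re + δ) ×ˢ Set.Ioo (z.im - δ) (z.im + δ)
    have hsub2 : Metric.ball z δ ⊆ Complex.measurableEquivRealProd ⁻¹' S := fun w hw ↦ by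
      have h1 := (Complex.abs_im_le_norm (w - z)).trans_lt (mem_ball_iff_norm.1 hw)
      have h2 := (Complex.abs_re_le_norm (w - z)).trans_lt (mem_ball_iff_norm.1 hw)
      rw [Complex.sub_im, abs_lt] at h1
      rw [Complex.sub_re, abs_lt] at h2
      simp only [S, Set.mem_preimage, Complex.measurableEquivRealProd_apply, Set.mem_prod,
        Set.mem_Ioo]
      refine ⟨⟨?_, ?_⟩, ?_, ?_⟩ <;> linarith
    have hSm : MeasurableSet S := measurableSet_Ioo.prod measurableSet_Ioo
    let W : ℂ → ℝ≥0∞ := {z : ℂ | 0 < z.im}.indicator fun w ↦ ‖v w‖ₑ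
    have hopen : IsOpen {z : ℂ | 0 < z.im} := isOpen_lt continuous_const Complex.continuous_im
    have hW : Measurable W :=
      measurable_indicator_of_continuousOn hopen.measurableSet
        (continuous_enorm.comp_continuousOn hv.continuousOn)
    have hWm : Measurable fun q : ℝ × ℝ ↦ W (Complex.measurableEquivRealProd.symm q) :=
      hW.comp Complex.measurableEquivRealProd.symm.measurable
    calc ∫⁻ w in Metric.ball z δ, ‖v w‖ₑ = ∫⁻ w in Metric.ball z δ, W w :=
          setLIntegral_congr_fun Metric.isOpen_ball.measurableSet fun w hw ↦ by
            simp only [W]; rw [Set.indicator_of_mem (hsub hw)]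
      _ ≤ ∫⁻ w in Complex.measurableEquivRealProd ⁻¹' S, W w := lintegral_mono_set hsub2
      _ = ∫⁻ q in S, W (Complex.measurableEquivRealProd.symm q) := by
          rw [← Complex.volume_preserving_equiv_real_prod.setLIntegral_comp_preimage hSm hWm]
          simp
      _ = ∫⁻ y in Set.Ioo (z.im - δ) (z.im + δ), ∫⁻ x in Set.Ioo (z.re - δ) (z.re + δ),
            W (Complex.measurableEquivRealProd.symm (x, y)) := by
          rw [Measure.volume_eq_prod, ← Measure.prod_restrict,
            lintegral_prod_symm _ hWm.aemeasurable]
      _ ≤ ∫⁻ y in Set.Ioo (z.im - δ) (z.im + δ),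
            M * ENNReal.ofReal (2 * δ) ^ (1 - 1 / p.toReal) := by
          refine setLIntegral_mono' measurableSet_Ioo fun y hy ↦ ?_
          have hy0 : 0 < y := by linarith [hy.1]
          have e : ∀ x, W (Complex.measurableEquivRealProd.symm (x, y)) =
              ‖v (x + Complex.I * y)‖ₑ := by
            intro x
            have : Complex.measurableEquivRealProd.symm (x, y) = x + Complex.I * y := by
              apply Complex.ext <;> simp
            rw [this]
            simp only [W]
            rw [Set.indicator_of_mem]
            simpa using hy0
          simp only [e]
          have := eLpNorm_le_eLpNorm_mul_rpow_measure_univ hp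
            (μ := volume.restrict (Set.Ioo (z.re - δ) (z.re + δ)))
            (hcont y hy0).aestronglyMeasurable
          rw [eLpNorm_one_eq_lintegral_enorm] at this
          refine this.trans ?_
          simp only [Measure.restrict_apply_univ, Real.volume_Ioo, ENNReal.toReal_one, div_one]
          rw [show z.re + δ - (z.re - δ) = 2 * δ by ring]
          gcongr
          exact (eLpNorm_mono_measure _ Measure.restrict_le_self).trans (hb y hy0)
      _ = B := by
          rw [setLIntegral_const, Real.volume_Ioo, mul_comm]
          congr 2; ring
  have h3 : ‖v z‖ₑ ≤ B / K := by
    rw [ENNReal.le_div_iff_mul_le (.inl hK0) (.inr hB), mul_comm]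
    exact h1.trans h2
  rw [← Real.norm_eq_abs, ← toReal_enorm]
  exact ENNReal.toReal_mono (ENNReal.div_ne_top hB hK0) h3

/-! ### Poisson's formula on a half plane -/

theorem exp_two_arctan_mul_I (s : ℝ) :
    Complex.exp (2 * Real.arctan s * Complex.I) = (1 + s * Complex.I) / (1 - s * Complex.I) := by
  have h0 : (1 : ℂ) - s * Complex.I ≠ 0 := fun h ↦ by simpa using congrArg Complex.re h
  have hs : (0:ℝ) < 1 + s ^ 2 := by positivity
  have hsq : √(1 + s ^ 2) ≠ 0 := (Real.sqrt_pos.2 hs).ne'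
  have e : Complex.exp (Real.arctan s * Complex.I) = (1 + s * Complex.I) / (√(1 + s ^ 2) : ℝ) := by
    rw [Complex.exp_mul_I, ← Complex.ofReal_cos, ← Complex.ofReal_sin, Real.cos_arctan,
      Real.sin_arctan]
    push_cast
    ring
  rw [show (2 : ℂ) * Real.arctan s * Complex.I =
      Real.arctan s * Complex.I + Real.arctan s * Complex.I by ring,
    Complex.exp_add, e, div_mul_div_comm, ← Complex.ofReal_mul, Real.mul_self_sqrt hs.le,
    div_eq_div_iff (by exact_mod_cast hs.ne') h0]
  push_cast
  linear_combination (1 + s * Complex.I) * (-(s:ℂ)^2) * Complex.I_sq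

/-- Stereographic parametrization of the circle of radius `1 / (2 ε)` tangent at `b` to the
horizontal line through `b`, from the point opposite to `b`. -/
theorem circleMap_arctan {ε : ℝ} (hε : ε ≠ 0) (b : ℂ) (t : ℝ) :
    circleMap (b + Complex.I * (1 / (2 * ε) : ℝ)) (1 / (2 * ε))
        (-(Real.pi / 2) + 2 * Real.arctan (ε * t)) =
      b + t / (1 - Complex.I * (ε * t : ℝ)) := by
  have h0 : (1 : ℂ) - Complex.I * (ε * t : ℝ) ≠ 0 := fun h ↦ by simpa using congrArg Complex.re h
  have hε' : (ε : ℂ) ≠ 0 := by exact_mod_cast hε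
  have e : ((-(Real.pi / 2) + 2 * Real.arctan (ε * t) : ℝ) : ℂ) * Complex.I =
      -(Real.pi / 2 * Complex.I) + 2 * Real.arctan (ε * t) * Complex.I := by push_cast; ring
  rw [circleMap, e, Complex.exp_add, exp_two_arctan_mul_I, Complex.exp_neg,
    Complex.exp_pi_div_two_mul_I, Complex.inv_I]
  have hs : (1 : ℂ) + (ε * t : ℝ) * Complex.I = 2 - (1 - Complex.I * (ε * t : ℝ)) := by ring
  rw [hs, mul_comm ((ε * t : ℝ) : ℂ)]
  have hD : Complex.I * (1 - Complex.I * (ε * t : ℝ)) - Complex.I = ε * t := by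
    push_cast; linear_combination (-(ε * t : ℂ)) * Complex.I_sq
  generalize (1 : ℂ) - Complex.I * (ε * t : ℝ) = D at *
  push_cast
  field_simp
  linear_combination 2 * hD

/-- Poisson's formula on a circle of radius `1 / (2 ε)` tangent at `b` to the line through `b`,
with the circle parametrized stereographically by that line. -/
theorem InnerProductSpace.HarmonicOnNhd.eq_integral_stereographic {v : ℂ → ℝ} {b : ℂ} {ε u : ℝ}
    (hε : 0 < ε) (hu : 0 < u) (hεu : u * ε < 1)
    (hv : InnerProductSpace.HarmonicOnNhd v
      (Metric.closedBall (b + Complex.I * (1 / (2 * ε) : ℝ)) (1 / (2 * ε)))) :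
    v (b + Complex.I * u) = ∫ t : ℝ,
      u * (1 - u * ε) / (Real.pi * ((1 - u * ε) ^ 2 * t ^ 2 + u ^ 2)) *
      v (b + t / (1 - Complex.I * (ε * t : ℝ))) := by
  have hpi := Real.pi_pos
  set R := 1 / (2 * ε) with hR
  have hR0 : 0 < R := by positivity
  have hRε : 2 * R * ε = 1 := by rw [hR]; field_simp
  set c := b + Complex.I * R with hc
  have hcw : b + Complex.I * u - c = Complex.I * (u - R : ℝ) := by rw [hc]; push_cast; ring
  have hwn : ‖b + Complex.I * u - c‖ = |u - R| := by
    rw [hcw, norm_mul, Complex.norm_I, one_mul, Complex.norm_real, Real.norm_eq_abs]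
  have hw : b + Complex.I * u ∈ Metric.ball c R := by
    rw [mem_ball_iff_norm, hwn, abs_lt]
    constructor
    · linarith
    · nlinarith
  have h := InnerProductSpace.HarmonicOnNhd.circleAverage_poissonKernel_smul hv hw
  set g : ℝ → ℝ := fun θ ↦ (poissonKernel c (b + Complex.I * u) • v) (circleMap c R θ) with hg
  have himg : (fun t : ℝ ↦ -(Real.pi / 2) + 2 * Real.arctan (ε * t)) '' Set.univ =
      Set.Ioo (-(3 * Real.pi / 2)) (Real.pi / 2) := by
    ext θ
    simp only [Set.image_univ, Set.mem_range, Set.mem_Ioo]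
    constructor
    · rintro ⟨t, rfl⟩
      have h1 := Real.neg_pi_div_two_lt_arctan (ε * t)
      have h2 := Real.arctan_lt_pi_div_two (ε * t)
      constructor <;> linarith
    · rintro ⟨h1, h2⟩
      refine ⟨Real.tan ((θ + Real.pi / 2) / 2) / ε, ?_⟩
      rw [mul_div_cancel₀ _ hε.ne', Real.arctan_tan (by linarith) (by linarith)]
      ring
  have hderiv : ∀ t ∈ (Set.univ : Set ℝ), HasDerivWithinAt
      (fun t : ℝ ↦ -(Real.pi / 2) + 2 * Real.arctan (ε * t))
      (2 * (1 / (1 + (ε * t) ^ 2) * ε)) Set.univ t := by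
    intro t _
    have h1 : HasDerivAt (fun t : ℝ ↦ ε * t) ε t := by simpa using (hasDerivAt_id t).const_mul ε
    exact ((h1.arctan.const_mul 2).const_add _).hasDerivWithinAt
  have hinj : Set.InjOn (fun t : ℝ ↦ -(Real.pi / 2) + 2 * Real.arctan (ε * t)) Set.univ := by
    intro s _ t _ hst
    have : Real.arctan (ε * s) = Real.arctan (ε * t) := by simpa using hst
    exact mul_left_cancel₀ hε.ne' (Real.arctan_injective this)
  have hcv := integral_image_eq_integral_abs_deriv_smul MeasurableSet.univ hderiv hinj g
  rw [himg, setIntegral_univ] at hcv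
  rw [Real.circleAverage_eq_integral_add (-(3 * Real.pi / 2)),
    intervalIntegral.integral_comp_add_right g,
    intervalIntegral.integral_of_le (by linarith), integral_Ioc_eq_integral_Ioo,
    show 0 + -(3 * Real.pi / 2) = -(3 * Real.pi / 2) by ring,
    show 2 * Real.pi + -(3 * Real.pi / 2) = Real.pi / 2 by ring, hcv, smul_eq_mul,
    ← integral_const_mul] at h
  rw [← h]
  refine integral_congr_ae (.of_forall fun t ↦ ?_)
  have hd : (0 : ℝ) < 1 + (ε * t) ^ 2 := by positivity
  have h0 : (1 : ℂ) - Complex.I * (ε * t : ℝ) ≠ 0 := fun h ↦ by simpa using congrArg Complex.re h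
  have hn0 : ‖(1 : ℂ) - Complex.I * (ε * t : ℝ)‖ ^ 2 = 1 + (ε * t) ^ 2 := by
    rw [← Complex.normSq_eq_norm_sq, Complex.normSq_apply]; simp; ring
  have hq : (0 : ℝ) < (1 - u * ε) ^ 2 * t ^ 2 + u ^ 2 := by positivity
  have hk : poissonKernel c (b + Complex.I * u) (b + t / (1 - Complex.I * (ε * t : ℝ))) =
      (R ^ 2 - (u - R) ^ 2) * (1 + (ε * t) ^ 2) / ((1 - u * ε) ^ 2 * t ^ 2 + u ^ 2) := by
    have h1 : ‖b + t / (1 - Complex.I * (ε * t : ℝ)) - c‖ = R := by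
      rw [← circleMap_arctan hε.ne' b t, hc, hR, circleMap_sub_center, norm_circleMap_zero]
      exact abs_of_pos hR0
    have h2 : b + t / (1 - Complex.I * (ε * t : ℝ)) - c - (b + Complex.I * u - c) =
        (((1 - u * ε) * t : ℝ) - Complex.I * u) / (1 - Complex.I * (ε * t : ℝ)) := by
      field_simp
      push_cast
      linear_combination (u * ε * t : ℂ) * Complex.I_sq
    have h3 : ‖(((1 - u * ε) * t : ℝ) - Complex.I * u : ℂ)‖ ^ 2 =
        (1 - u * ε) ^ 2 * t ^ 2 + u ^ 2 := by
      rw [← Complex.normSq_eq_norm_sq, Complex.normSq_apply]; simp; ring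
    rw [poissonKernel_def, h1, hwn, h2, norm_div,
      div_pow ‖((((1 - u * ε) * t : ℝ) : ℂ) - Complex.I * u)‖, hn0, h3, sq_abs]
    field_simp
  have hgt : g (-(Real.pi / 2) + 2 * Real.arctan (ε * t)) =
      (R ^ 2 - (u - R) ^ 2) * (1 + (ε * t) ^ 2) /
      ((1 - u * ε) ^ 2 * t ^ 2 + u ^ 2) * v (b + t / (1 - Complex.I * (ε * t : ℝ))) := by
    simp only [hg, Pi.smul_apply', smul_eq_mul]
    rw [hc, hR, circleMap_arctan hε.ne', ← hk]
  dsimp only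
  rw [hgt, abs_of_pos (by positivity), smul_eq_mul]
  have : (2 * Real.pi)⁻¹ * (2 * (1 / (1 + (ε * t) ^ 2) * ε) *
      ((R ^ 2 - (u - R) ^ 2) * (1 + (ε * t) ^ 2) / ((1 - u * ε) ^ 2 * t ^ 2 + u ^ 2))) =
      u * (1 - u * ε) / (Real.pi * ((1 - u * ε) ^ 2 * t ^ 2 + u ^ 2)) := by
    field_simp
    linear_combination u * hRε
  rw [← this]
  ring

/-- Poisson's formula for a bounded harmonic function on a half plane, as the limit of the formulas
on tangent discs of radius `1 / (2 ε)`, `ε → 0`. -/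
theorem InnerProductSpace.HarmonicOnNhd.eq_integral_linePoissonKernel {v : ℂ → ℝ} {b : ℂ}
    {u C : ℝ} (hu : 0 < u)
    (hv : InnerProductSpace.HarmonicOnNhd v {z : ℂ | 0 < z.im}) (hb : 0 < b.im)
    (hC : ∀ z : ℂ, b.im ≤ z.im → |v z| ≤ C) :
    v (b + Complex.I * u) = ∫ t : ℝ, linePoissonKernel u t * v (b + t) := by
  have hpi := Real.pi_pos
  have him : ∀ ε t : ℝ, 0 ≤ ε → b.im ≤ (b + t / (1 - Complex.I * (ε * t : ℝ))).im := by
    intro ε t hε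
    have : (t / (1 - Complex.I * (ε * t : ℝ)) : ℂ).im =
        ε * t ^ 2 / Complex.normSq (1 - Complex.I * (ε * t : ℝ)) := by
      rw [Complex.div_im]; simp; ring
    rw [Complex.add_im, this]
    have := Complex.normSq_nonneg (1 - Complex.I * (ε * t : ℝ))
    have : 0 ≤ ε * t ^ 2 / Complex.normSq (1 - Complex.I * (ε * t : ℝ)) := by positivity
    linarith
  have hC0 : 0 ≤ C := (abs_nonneg _).trans (hC b le_rfl)
  have hev : ∀ᶠ ε : ℝ in 𝓝[>] 0, 0 < ε ∧ u * ε < 1 / 2 := by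
    refine (eventually_mem_nhdsWithin).and (eventually_nhdsWithin_of_eventually_nhds ?_)
    have : Tendsto (fun ε : ℝ ↦ u * ε) (𝓝 0) (𝓝 (u * 0)) :=
      (continuous_const.mul continuous_id).tendsto 0
    exact this.eventually_lt_const (by norm_num)
  have hcont : ∀ ε : ℝ, 0 ≤ ε →
      Continuous fun t : ℝ ↦ v (b + t / (1 - Complex.I * (ε * t : ℝ))) := by
    intro ε hε
    refine hv.continuousOn.comp_continuous ?_ fun t ↦ hb.trans_le (him ε t hε)
    have : ∀ t : ℝ, (1 : ℂ) - Complex.I * (ε * t : ℝ) ≠ 0 := fun t h ↦ by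
      simpa using congrArg Complex.re h
    fun_prop (disch := assumption)
  have hT : Tendsto (fun ε : ℝ ↦ ∫ t : ℝ,
      u * (1 - u * ε) / (Real.pi * ((1 - u * ε) ^ 2 * t ^ 2 + u ^ 2)) *
      v (b + t / (1 - Complex.I * (ε * t : ℝ)))) (𝓝[>] 0)
      (𝓝 (∫ t : ℝ, linePoissonKernel u t * v (b + t))) := by
    refine tendsto_integral_filter_of_dominated_convergence
      (fun t ↦ 4 * linePoissonKernel u t * C) ?_ ?_ ?_ ?_
    · filter_upwards [hev] with ε hε
      have h1 := hcont ε hε.1.le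
      have h2 : Continuous fun t : ℝ ↦
          u * (1 - u * ε) / (Real.pi * ((1 - u * ε) ^ 2 * t ^ 2 + u ^ 2)) := by
        have : ∀ t : ℝ, Real.pi * ((1 - u * ε) ^ 2 * t ^ 2 + u ^ 2) ≠ 0 := fun t ↦ by positivity
        fun_prop (disch := assumption)
      exact (h2.mul h1).aestronglyMeasurable
    · filter_upwards [hev] with ε hε
      refine .of_forall fun t ↦ ?_
      have hε1 := mul_pos hu hε.1
      have hε2 := hε.2
      rw [norm_mul]
      refine mul_le_mul ?_ (hC _ (him ε t hε.1.le)) (norm_nonneg _) (by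
        have := linePoissonKernel_nonneg hu.le t; positivity)
      have h3 : 0 < 1 - u * ε := by linarith
      rw [Real.norm_of_nonneg (by positivity), linePoissonKernel, mul_div_assoc',
        div_le_div_iff₀ (by positivity) (by positivity)]
      -- `u * ε < 1 / 2` keeps the rescaled kernel within a factor `4` of `P_u`.
      have h4 : 1 ≤ 4 * (1 - u * ε) ^ 2 := by nlinarith
      have h5 : (1 - u * ε) * (u ^ 2 + t ^ 2) ≤ 4 * ((1 - u * ε) ^ 2 * t ^ 2 + u ^ 2) := by
        nlinarith [mul_nonneg (sub_nonneg.2 h4) (sq_nonneg t), mul_pos hε1 (pow_pos hu 2),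
          mul_nonneg hε1.le (sq_nonneg t), sq_nonneg u]
      nlinarith [mul_le_mul_of_nonneg_left h5 (mul_pos hu hpi).le]
    · exact ((integrable_linePoissonKernel hu.ne').const_mul 4).mul_const C
    · refine .of_forall fun t ↦ ?_
      have h1 : ContinuousAt (fun ε : ℝ ↦ b + t / (1 - Complex.I * (ε * t : ℝ))) 0 := by
        have : (1 : ℂ) - Complex.I * ((0 : ℝ) * t : ℝ) ≠ 0 := by simp
        fun_prop (disch := assumption)
      have h2 : ContinuousAt v (b + t / (1 - Complex.I * ((0 : ℝ) * t : ℝ))) :=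
        (hv _ (hb.trans_le (him 0 t le_rfl))).1.continuousAt
      have h3 : ContinuousAt (fun ε : ℝ ↦ v (b + t / (1 - Complex.I * (ε * t : ℝ)))) 0 :=
        ContinuousAt.comp (f := fun ε : ℝ ↦ b + t / (1 - Complex.I * (ε * t : ℝ))) h2 h1
      have h4 : ContinuousAt (fun ε : ℝ ↦
          u * (1 - u * ε) / (Real.pi * ((1 - u * ε) ^ 2 * t ^ 2 + u ^ 2))) 0 := by
        have : Real.pi * ((1 - u * 0) ^ 2 * t ^ 2 + u ^ 2) ≠ 0 := by positivity
        fun_prop (disch := assumption)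
      have h5 := (h4.mul h3).tendsto
      refine (h5.mono_left nhdsWithin_le_nhds).trans (le_of_eq ?_)
      simp [linePoissonKernel, add_comm]
  refine tendsto_nhds_unique (tendsto_const_nhds.congr' ?_) hT
  filter_upwards [hev] with ε hε
  refine InnerProductSpace.HarmonicOnNhd.eq_integral_stereographic hε.1 hu
    (by linarith [hε.2]) (hv.mono fun z hz ↦ ?_)
  have h1 := (Complex.abs_im_le_norm _).trans (mem_closedBall_iff_norm.1 hz)
  simp only [Complex.sub_im, Complex.add_im, Complex.mul_im, Complex.I_re, Complex.I_im,
    Complex.ofReal_im, Complex.ofReal_re, abs_le] at h1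
  simp only [Set.mem_ofPred_eq]
  linarith [h1.1]

/-! ### Convolution with the Poisson kernel -/

/-- Young's inequality for convolution with a probability measure: Jensen's inequality, then
Tonelli's theorem and translation invariance. -/
theorem eLpNorm_lintegral_comp_sub_le {ν : Measure ℝ} [IsProbabilityMeasure ν] (hν : ν ≪ volume)
    {p : ℝ≥0∞} (hp : 1 ≤ p) {g : ℝ → ℝ≥0∞} (hg : Measurable g) :
    eLpNorm (fun x ↦ ∫⁻ t, g (x - t) ∂ν) p volume ≤ eLpNorm g p volume := by
  have hp0 : p ≠ 0 := (zero_lt_one.trans_le hp).ne'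
  by_cases hp' : p = ∞
  · subst hp'
    rw [eLpNorm_exponent_top, eLpNorm_exponent_top]
    refine essSup_le_of_ae_le _ (.of_forall fun x ↦ ?_)
    have h1 : ∀ᵐ t ∂ν, g (x - t) ≤ eLpNormEssSup g volume := by
      have h := (Measure.measurePreserving_sub_left
        (volume : Measure ℝ) x).quasiMeasurePreserving.ae
        (enorm_ae_le_eLpNormEssSup g volume)
      simp only [enorm_eq_self] at h
      exact hν.ae_le h
    calc ‖∫⁻ t, g (x - t) ∂ν‖ₑ ≤ ∫⁻ _, eLpNormEssSup g volume ∂ν := lintegral_mono_ae h1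
      _ = _ := by simp
  · have hr := ENNReal.toReal_pos hp0 hp'
    rw [eLpNorm_eq_lintegral_rpow_enorm_toReal hp0 hp',
      eLpNorm_eq_lintegral_rpow_enorm_toReal hp0 hp']
    refine ENNReal.rpow_le_rpow ?_ (by positivity)
    simp only [enorm_eq_self]
    calc ∫⁻ x, (∫⁻ t, g (x - t) ∂ν) ^ p.toReal ≤ ∫⁻ x, ∫⁻ t, g (x - t) ^ p.toReal ∂ν := by
          refine lintegral_mono fun x ↦ ?_
          have := eLpNorm_le_eLpNorm_of_exponent_le hp (μ := ν) (f := fun t ↦ g (x - t))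
            (by fun_prop : Measurable fun t ↦ g (x - t)).aestronglyMeasurable
          rw [eLpNorm_one_eq_lintegral_enorm, eLpNorm_eq_lintegral_rpow_enorm_toReal hp0 hp',
            one_div, ENNReal.le_rpow_inv_iff hr] at this
          simpa using this
      _ = ∫⁻ t, (∫⁻ x, g (x - t) ^ p.toReal) ∂ν := lintegral_lintegral_swap (by fun_prop)
      _ = ∫⁻ _, (∫⁻ x, g x ^ p.toReal) ∂ν := lintegral_congr fun t ↦
          lintegral_sub_right_eq_self (fun x ↦ g x ^ p.toReal) t
      _ = _ := by simp

theorem eLpNorm_linePoissonKernel_convolution_le {u : ℝ} (hu : 0 < u) {p : ℝ≥0∞} (hp : 1 ≤ p)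
    {f : ℝ → ℂ} (hf : AEStronglyMeasurable f volume) :
    eLpNorm (linePoissonKernel u ⋆[ContinuousLinearMap.lsmul ℝ ℝ] f) p volume ≤
      eLpNorm f p volume := by
  have hc := (continuous_linePoissonKernel hu.ne').measurable
  obtain ⟨g, hg, hfg⟩ := hf
  set κ : ℝ → ℝ≥0∞ := fun t ↦ ENNReal.ofReal (linePoissonKernel u t) with hκ
  have hκm : Measurable κ := hc.ennreal_ofReal
  have hν : IsProbabilityMeasure (volume.withDensity κ) := ⟨by
    rw [withDensity_apply _ .univ, setLIntegral_univ, hκ, ← ofReal_integral_eq_lintegral_ofReal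
      (integrable_linePoissonKernel hu.ne') (.of_forall (linePoissonKernel_nonneg hu.le)),
      integral_linePoissonKernel hu, ENNReal.ofReal_one]⟩
  have hm : Measurable fun x ↦ ‖g x‖ₑ := hg.measurable.enorm
  have hpt : ∀ x, ‖(linePoissonKernel u ⋆[ContinuousLinearMap.lsmul ℝ ℝ] f) x‖ₑ ≤
      ∫⁻ t, ‖g (x - t)‖ₑ ∂(volume.withDensity κ) := by
    intro x
    have hmx : Measurable fun t ↦ ‖g (x - t)‖ₑ := hm.comp (measurable_const.sub measurable_id)
    rw [lintegral_withDensity_eq_lintegral_mul _ hκm hmx, convolution_def]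
    refine (enorm_integral_le_lintegral_enorm _).trans (lintegral_mono_ae ?_)
    have := (Measure.measurePreserving_sub_left
      (volume : Measure ℝ) x).quasiMeasurePreserving.ae hfg
    filter_upwards [this] with t ht
    rw [ContinuousLinearMap.lsmul_apply, enorm_smul, ht,
      Real.enorm_of_nonneg (linePoissonKernel_nonneg hu.le t)]
    simp [hκ]
  have h1 : eLpNorm (linePoissonKernel u ⋆[ContinuousLinearMap.lsmul ℝ ℝ] f) p volume ≤
      eLpNorm (fun x ↦ ∫⁻ t, ‖g (x - t)‖ₑ ∂(volume.withDensity κ)) p volume :=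
    eLpNorm_mono_enorm fun x ↦ (hpt x).trans_eq (enorm_eq_self _).symm
  have h2 := eLpNorm_lintegral_comp_sub_le (withDensity_absolutelyContinuous volume κ) hp hm
  rw [eLpNorm_enorm g, ← eLpNorm_congr_ae hfg] at h2
  exact h1.trans h2

/-! ### Poisson integrals of functions in `L^p` -/

/-- Real-valued harmonic functions with slices bounded in `L^p` are Poisson integrals: the density is
a weak-* limit of the slices at heights tending to `0`. -/
theorem InnerProductSpace.HarmonicOnNhd.exists_memLp_eq_integral {v : ℂ → ℝ} {p M : ℝ≥0∞}
    (hp : 1 < p) (hM : M ≠ ∞)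
    (hv : InnerProductSpace.HarmonicOnNhd v {z : ℂ | 0 < z.im})
    (hb : ∀ u : ℝ, 0 < u → eLpNorm (fun x : ℝ ↦ v (x + Complex.I * u)) p volume ≤ M) :
    ∃ f : ℝ → ℝ, MemLp f p volume ∧ ∀ u : ℝ, 0 < u → ∀ x : ℝ,
      v (x + Complex.I * u) = ∫ t, f t * linePoissonKernel u (x - t) := by
  have : p.HolderConjugate p.conjExponent := .conjExponent hp.le
  have hq : p.conjExponent ≠ ∞ :=
    ((ENNReal.HolderConjugate.lt_top_iff_one_lt p.conjExponent p).2 hp).ne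
  have hq1 : 1 ≤ p.conjExponent := ENNReal.HolderConjugate.one_le p.conjExponent p
  have hcont : ∀ u : ℝ, 0 < u → Continuous fun x : ℝ ↦ v (x + Complex.I * u) := fun u hu ↦
    hv.continuousOn.comp_continuous (by fun_prop) fun x ↦ by simpa using hu
  let d : ℕ → ℝ := fun n ↦ 1 / ((n : ℝ) + 1)
  have hd : ∀ n, 0 < d n := fun n ↦ by positivity
  have hd0 : Tendsto d atTop (𝓝 0) := tendsto_one_div_add_atTop_nhds_zero_nat
  obtain ⟨f, hf, hT⟩ := exists_ultrafilter_weakStar_limit (μ := volume) (p := p) hq hM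
    (Ultrafilter.of (atTop : Filter ℕ)) (f := fun n (x : ℝ) ↦ v (x + Complex.I * d n))
    (fun n ↦ (hcont _ (hd n)).measurable) fun n ↦ hb _ (hd n)
  refine ⟨f, hf, fun u hu x ↦ ?_⟩
  have hψc : Continuous fun t : ℝ ↦ linePoissonKernel u (x - t) :=
    (continuous_linePoissonKernel hu.ne').comp (by fun_prop)
  have h1 := hT (fun t ↦ linePoissonKernel u (x - t)) hψc.measurable
    (fun t ↦ linePoissonKernel_nonneg hu.le _)
    ((memLp_linePoissonKernel hu hq1 hq).comp_measurePreserving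
      (Measure.measurePreserving_sub_left (volume : Measure ℝ) x))
  refine tendsto_nhds_unique ?_ h1
  have h2 : Tendsto (fun n ↦ v (x + Complex.I * u + Complex.I * d n)) atTop
      (𝓝 (v (x + Complex.I * u))) := by
    have hz : (x + Complex.I * u : ℂ) ∈ {z : ℂ | 0 < z.im} := by simpa using hu
    refine (hv _ hz).1.continuousAt.tendsto.comp ?_
    have : Continuous fun s : ℝ ↦ (x + Complex.I * u + Complex.I * s : ℂ) := by fun_prop
    have := (this.tendsto 0).comp hd0
    simpa [Function.comp_def] using this
  refine (h2.mono_left (Ultrafilter.of_le _)).congr fun n ↦ ?_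
  obtain ⟨C, hC⟩ := InnerProductSpace.HarmonicOnNhd.exists_bound_of_eLpNorm_slice_le
    hp.le hM hv hb (hd n)
  have h3 := InnerProductSpace.HarmonicOnNhd.eq_integral_linePoissonKernel
    (b := x + Complex.I * d n) hu hv
    (by simpa using hd n) (C := C) (fun z hz ↦ hC z (by simpa using hz))
  rw [show (x + Complex.I * u + Complex.I * d n : ℂ) = x + Complex.I * d n + Complex.I * u by ring,
    h3,
    ← integral_sub_right_eq_self _ x]
  refine integral_congr_ae (.of_forall fun t ↦ ?_)
  dsimp only
  rw [← linePoissonKernel_neg, neg_sub, mul_comm]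
  congr 2
  push_cast; ring

theorem theorem2p4 (F : ℂ → ℂ)
    (hF : InnerProductSpace.HarmonicOnNhd F {z : ℂ | 0 < z.im})
    (p : ℝ≥0∞) (hp : 1 < p) :
    (∃ f : ℝ → ℂ, MeasureTheory.MemLp f p MeasureTheory.volume ∧
      ∀ u : ℝ, 0 < u → ∀ x : ℝ,
        horizontalSlice F u x = (linePoissonKernel u ⋆[ContinuousLinearMap.lsmul ℝ ℝ] f) x) ↔
    (∀ u : ℝ, 0 < u → MeasureTheory.MemLp (horizontalSlice F u) p MeasureTheory.volume) ∧
      (⨆ u : ℝ, ⨆ _ : 0 < u,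
        MeasureTheory.eLpNorm (horizontalSlice F u) p MeasureTheory.volume) < ∞ := by
  have hcont : ∀ u : ℝ, 0 < u → Continuous (horizontalSlice F u) := fun u hu ↦
    hF.continuousOn.comp_continuous (by fun_prop) fun x ↦ by simpa using hu
  constructor
  · rintro ⟨f, hf, hrep⟩
    have hle : ∀ u : ℝ, 0 < u → eLpNorm (horizontalSlice F u) p volume ≤ eLpNorm f p volume := by
      intro u hu
      rw [funext (hrep u hu)]
      exact eLpNorm_linePoissonKernel_convolution_le hu hp.le hf.1
    exact ⟨fun u hu ↦ ⟨(hcont u hu).aestronglyMeasurable, (hle u hu).trans_lt hf.2⟩,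
      (iSup₂_le hle).trans_lt hf.2⟩
  · rintro ⟨-, hsup⟩
    set M := ⨆ u : ℝ, ⨆ _ : 0 < u, eLpNorm (horizontalSlice F u) p volume
    have hb : ∀ u : ℝ, 0 < u → eLpNorm (horizontalSlice F u) p volume ≤ M := fun u hu ↦
      le_iSup₂ (f := fun u (_ : 0 < u) ↦ eLpNorm (horizontalSlice F u) p volume) u hu
    obtain ⟨a, ha, hra⟩ := InnerProductSpace.HarmonicOnNhd.exists_memLp_eq_integral hp hsup.ne
      (hF.comp_CLM Complex.reCLM) fun u hu ↦
        (eLpNorm_mono fun x ↦ Complex.abs_re_le_norm (horizontalSlice F u x)).trans (hb u hu)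
    obtain ⟨b, hb, hrb⟩ := InnerProductSpace.HarmonicOnNhd.exists_memLp_eq_integral hp hsup.ne
      (hF.comp_CLM Complex.imCLM) fun u hu ↦
        (eLpNorm_mono fun x ↦ Complex.abs_im_le_norm (horizontalSlice F u x)).trans (hb u hu)
    have : p.HolderConjugate p.conjExponent := .conjExponent hp.le
    have hq : p.conjExponent ≠ ∞ :=
      ((ENNReal.HolderConjugate.lt_top_iff_one_lt p.conjExponent p).2 hp).ne
    have hq1 : 1 ≤ p.conjExponent := ENNReal.HolderConjugate.one_le p.conjExponent p
    have ha' : MemLp (fun t ↦ (a t : ℂ)) p volume := ha.ofReal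
    have hb' : MemLp (fun t ↦ (b t : ℂ)) p volume := hb.ofReal
    have hab : MemLp (fun t ↦ (a t : ℂ) + Complex.I * b t) p volume :=
      ha'.add (hb'.const_mul Complex.I)
    refine ⟨fun t ↦ a t + Complex.I * b t, hab, fun u hu x ↦ ?_⟩
    have hψ := (memLp_linePoissonKernel hu hq1 hq).comp_measurePreserving
      (Measure.measurePreserving_sub_left (volume : Measure ℝ) x)
    have hia : Integrable (fun t ↦ a t * linePoissonKernel u (x - t)) := ha.integrable_mul hψ
    have hib : Integrable (fun t ↦ b t * linePoissonKernel u (x - t)) := hb.integrable_mul hψ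
    have hia' : Integrable (fun t ↦ ((a t * linePoissonKernel u (x - t) : ℝ) : ℂ)) := hia.ofReal
    have hib' : Integrable (fun t ↦ ((b t * linePoissonKernel u (x - t) : ℝ) : ℂ)) := hib.ofReal
    have h1 : ∀ w : ℂ, w = w.re + Complex.I * w.im := fun w ↦ by rw [mul_comm, Complex.re_add_im]
    have h2 : (F (x + Complex.I * u)).re = _ := hra u hu x
    have h3 : (F (x + Complex.I * u)).im = _ := hrb u hu x
    have h4 : ∫ t, linePoissonKernel u (x - t) • ((a t : ℂ) + Complex.I * b t) =
        ((∫ t, a t * linePoissonKernel u (x - t) : ℝ) : ℂ) +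
          Complex.I * ((∫ t, b t * linePoissonKernel u (x - t) : ℝ) : ℂ) := by
      rw [← integral_complex_ofReal, ← integral_complex_ofReal, ← integral_const_mul,
        ← integral_add hia' (hib'.const_mul Complex.I)]
      refine integral_congr_ae (.of_forall fun t ↦ ?_)
      simp only [Complex.real_smul]
      push_cast
      ring
    rw [convolution_eq_swap]
    simp only [ContinuousLinearMap.lsmul_apply]
    rw [h4, horizontalSlice, h1 (F _), h2, h3]
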